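/- Let $F$ be a field of characteristic zero. An algebra with trace is a nonzero unital associative $F$-algebra $A$ with an $F$-linear map $\mathrm{tr}\colon A\to F$ such that $\mathrm{tr}(ab)=\mathrm{tr}(ba)$ for all $a,b\in A$. Let $F\langle X,\mathrm{Tr}\rangle=F\langle X\rangle\otimes_F F[\mathrm{Tr}(M)]$ be the free algebra with trace on $X=\{x_1,x_2,\dots\}$, where $M$ runs over the nonempty monomials in $X$, the $\mathrm{Tr}(M)$ are commuting central variables, and $\mathrm{Tr}(MN)=\mathrm{Tr}(NM)$. Let $\mathrm{Id}^{tr}(A)\subseteq F\langle X,\mathrm{Tr}\rangle$ be the set of trace identities of $A$, i.e. of those $f$ that vanish whenever the $x_i$ are replaced by elements of $A$ and $\mathrm{Tr}$ by $\mathrm{tr}$. A variety is the class of all algebras with trace satisfying a given set of trace identities; $\mathrm{var}^{tr}(A)$ is the class of all $B$ with $\mathrm{Id}^{tr}(A)\subseteq \mathrm{Id}^{tr}(B)$. For a variety $\mathcal V$ let $\mathrm{Id}^{tr}(\mathcal V)=\bigcap_{B\in\mathcal V}\mathrm{Id}^{tr}(B)$, let $MT_n$ be the span of all products $\mathrm{Tr}(w_1)\cdots\mathrm{Tr}(w_m)\,w_0$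 ($m\ge 0$; $w_1,\dots,w_m$ nonempty words, $w_0$ a possibly empty word) in which each of $x_1,\dots,x_n$ occurs exactly once and no other variable occurs, and put $c_n^{tr}(\mathcal V)=\dim_F MT_n/(MT_n\cap \mathrm{Id}^{tr}(\mathcal V))$. Write $a_n\approx b_n$ if $a_n/b_n\to 1$ as $n\to\infty$. A variety $\mathcal V$ is minimal of polynomial growth if $c_n^{tr}(\mathcal V)\approx q n^{d}$ for some integer $d\ge 1$ and real $q>0$, and for every finite-dimensional algebra with trace $A$ with $\mathrm{var}^{tr}(A)\subsetneq\mathcal V$ one has $c_n^{tr}(\mathrm{var}^{tr}(A))\approx q' n^{t}$ for some integer $0\le t<d$ and some real $q'>0$. For $k\ge 2$ let $C_k$ be the algebra of upper triangular $k\times k$ matrices over $F$ that are constant along each diagonal (so $C_k\cong F[x]/(x^k)$), and for $\alpha\in F$ let $C_k^{t_{\alpha,0}}$ be $C_k$ with the trace that sends a matrix with diagonal entry $a_1$ to $\alpha a_1$. Theorem. For every $k\ge 2$ and every $\alpha\in F\setminus\{0\}$, the variety $\mathrm{var}^{tr}(C_k^{t_{\alpha,0}})$ generated by $C_k^{t_{\alpha,0}}$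 is minimal of polynomial growth. -/

import Mathlib

universe u

/-- A (unitary, associative) algebra with trace over the field `F`: a nonzero unital `F`-algebra
(so that `F = F · 1 ⊆ A`) with an `F`-linear map `tr : A → F` such that `tr (a b) = tr (b a)`. -/
structure TraceAlgebra (F : Type u) [Field F] : Type (u + 1) where
  carrier : Type u
  [ring : Ring carrier]
  [algebra : Algebra F carrier]
  [nontrivial : Nontrivial carrier]
  tr : carrier →ₗ[F] F
  tr_mul_comm : ∀ a b : carrier, tr (a * b) = tr (b * a)

attribute [instance] TraceAlgebra.ring TraceAlgebra.algebra TraceAlgebra.nontrivial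

/-- Nonempty words in the variables `x_0, x_1, …` up to cyclic rotation. These are the nonempty
monomials `M` modulo `M N ∼ N M`, and they index the commuting variables `Tr(M)`. -/
abbrev TraceWord : Type := {c : Cycle ℕ // c ≠ Cycle.nil}

/-- The free algebra with trace `F⟨X, Tr⟩ = F⟨X⟩ ⊗ F[Tr(M) | M]` on `X = {x_0, x_1, …}`.
Here `Tr(M N) = Tr(N M)`, and the elements `Tr(M)` are central and commute. -/
def FreeTraceAlgebra (F : Type u) [Field F] : Type u :=
  TensorProduct F (FreeAlgebra F ℕ) (MvPolynomial TraceWord F)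

noncomputable instance (F : Type u) [Field F] : Ring (FreeTraceAlgebra F) :=
  inferInstanceAs (Ring (TensorProduct F (FreeAlgebra F ℕ) (MvPolynomial TraceWord F)))

noncomputable instance (F : Type u) [Field F] : Algebra F (FreeTraceAlgebra F) :=
  inferInstanceAs (Algebra F (TensorProduct F (FreeAlgebra F ℕ) (MvPolynomial TraceWord F)))

namespace TraceAlgebra

variable {F : Type u} [Field F]

lemma tr_prod_rotate (A : TraceAlgebra F) (a : ℕ → A.carrier) {l₁ l₂ : List ℕ}
    (h : l₁ ~r l₂) : A.tr (l₁.map a).prod = A.tr (l₂.map a).prod := by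
  obtain ⟨n, rfl⟩ := h
  rw [List.rotate_eq_drop_append_take_mod, List.map_append, List.prod_append, A.tr_mul_comm,
    ← List.prod_append, ← List.map_append, List.take_append_drop]

/-- The value `tr (a_{i₁} ⋯ a_{iₘ})` of `Tr(x_{i₁} ⋯ x_{iₘ})` under `x_i ↦ a_i`. -/
def evalWord (A : TraceAlgebra F) (a : ℕ → A.carrier) (c : TraceWord) : F :=
  Quotient.lift (s := List.IsRotated.setoid ℕ) (fun l : List ℕ => A.tr (l.map a).prod)
    (fun _ _ h => A.tr_prod_rotate a h) c.1

/-- Evaluation of trace polynomials in `A`: `x_i` goes to `a i` and `Tr` to the trace of `A`. -/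
noncomputable def eval (A : TraceAlgebra F) (a : ℕ → A.carrier) :
    FreeTraceAlgebra F →ₐ[F] A.carrier :=
  Algebra.TensorProduct.lift (FreeAlgebra.lift F a)
    ((Algebra.ofId F A.carrier).comp (MvPolynomial.aeval (A.evalWord a)))
    (fun x y => (Algebra.commutes (MvPolynomial.aeval (A.evalWord a) y)
      (FreeAlgebra.lift F a x)).symm)

/-- `Id^tr(A)`: the trace polynomials that vanish under every evaluation in `A`. -/
noncomputable def trId (A : TraceAlgebra F) : Submodule F (FreeTraceAlgebra F) :=
  ⨅ a : ℕ → A.carrier, LinearMap.ker (A.eval a).toLinearMap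

lemma mem_trId (A : TraceAlgebra F) (f : FreeTraceAlgebra F) :
    f ∈ A.trId ↔ ∀ a : ℕ → A.carrier, A.eval a f = 0 := by
  simp [trId]

end TraceAlgebra

section Multilinear

variable (F : Type u) [Field F]

/-- The trace polynomial `Tr(w)` of a nonempty word `w`. -/
noncomputable def trVar (w : {w : List ℕ // w ≠ []}) : FreeTraceAlgebra F :=
  (1 : FreeAlgebra F ℕ) ⊗ₜ[F]
    MvPolynomial.X (⟨(w.1 : Cycle ℕ), fun h => w.2 ((Cycle.coe_eq_nil w.1).mp h)⟩ : TraceWord)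

/-- The trace polynomial `x_{l₁} ⋯ x_{l_c}` (no traces). -/
noncomputable def wordMonomial (w : List ℕ) : FreeTraceAlgebra F :=
  (w.map (FreeAlgebra.ι F)).prod ⊗ₜ[F] (1 : MvPolynomial TraceWord F)

/-- `MT_n`: the multilinear trace polynomials in the first `n` variables `x_0, …, x_{n-1}`, spanned
by the products `Tr(w₁) ⋯ Tr(w_m) x_{l₁} ⋯ x_{l_c}` (`w_j` nonempty, `m, c ≥ 0`) in which each
of these variables occurs exactly once and no other variable occurs. -/
noncomputable def multilinearTrace (n : ℕ) : Submodule F (FreeTraceAlgebra F) :=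
  Submodule.span F {f | ∃ (ws : List {w : List ℕ // w ≠ []}) (l : List ℕ),
    ((ws.map Subtype.val).flatten ++ l).Perm (List.range n) ∧
      f = (ws.map (trVar F)).prod * wordMonomial F l}

end Multilinear

section Varieties

variable {F : Type u} [Field F]

/-- A variety of algebras with trace: the class of all those that satisfy a given set of trace
identities. -/
def IsTraceVariety (V : Set (TraceAlgebra F)) : Prop :=
  ∃ S : Set (FreeTraceAlgebra F), V = {B | ∀ f ∈ S, f ∈ B.trId}

/-- `var^tr(A)`: the variety generated by `A`, that is the class of all algebras with trace that
satisfy all the trace identities of `A`. -/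
def generatedVariety (A : TraceAlgebra F) : Set (TraceAlgebra F) :=
  {B | ∀ f ∈ A.trId, f ∈ B.trId}

/-- The trace identities satisfied by all members of a class of algebras with trace. -/
noncomputable def classTrId (V : Set (TraceAlgebra F)) : Submodule F (FreeTraceAlgebra F) :=
  ⨅ B ∈ V, B.trId

/-- The trace codimension `c_n^tr(V) = dim_F MT_n / (MT_n ∩ Id^tr(V))`. (`MT_n` is
finite-dimensional.) -/
noncomputable def trCodim (V : Set (TraceAlgebra F)) (n : ℕ) : ℕ :=
  Module.finrank F
    (multilinearTrace F n ⧸ (classTrId V).comap (multilinearTrace F n).subtype)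

/-- `c_n^tr(V) ≈ q n^d` as `n → ∞` (the quotient tends to `1`). -/
def CodimAsymp (V : Set (TraceAlgebra F)) (q : ℝ) (d : ℕ) : Prop :=
  Asymptotics.IsEquivalent Filter.atTop (fun n : ℕ => (trCodim V n : ℝ))
    (fun n : ℕ => q * (n : ℝ) ^ d)

/-- `V` is a minimal variety of polynomial growth: `c_n^tr(V) ≈ q n^d` with `d ≥ 1`, `q > 0`, and
every proper subvariety `U` generated by a finite-dimensional (unitary) algebra with trace has
`c_n^tr(U) ≈ q' n^t` with `t < d` (and `q' > 0`). -/
def IsMinimalOfPolynomialGrowth (V : Set (TraceAlgebra F)) : Prop :=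
  IsTraceVariety V ∧
    ∃ d : ℕ, 1 ≤ d ∧ (∃ q : ℝ, 0 < q ∧ CodimAsymp V q d) ∧
      ∀ A : TraceAlgebra F, FiniteDimensional F A.carrier → generatedVariety A ⊂ V →
        ∃ t : ℕ, t < d ∧ ∃ q' : ℝ, 0 < q' ∧ CodimAsymp (generatedVariety A) q' t

end Varieties

section TruncatedPolynomials

variable (F : Type u) [Field F]

/-- The upper triangular `k × k` matrix with constant diagonals, whose entry at place `(i, j)` is
`a (j - i)` for `i ≤ j`. -/
def toeplitz (k : ℕ) (a : ℕ → F) : Matrix (Fin k) (Fin k) F :=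
  Matrix.of fun i j => if i ≤ j then a ((j : ℕ) - (i : ℕ)) else 0

variable {F}

lemma toeplitz_mul (k : ℕ) (a b : ℕ → F) :
    toeplitz F k a * toeplitz F k b =
      toeplitz F k (fun m => ∑ p ∈ Finset.HasAntidiagonal.antidiagonal m, a p.1 * b p.2) := by
  ext i j
  simp only [toeplitz, Matrix.mul_apply, Matrix.of_apply]
  by_cases hij : i ≤ j
  · rw [if_pos hij]
    symm
    rw [← Finset.sum_filter_of_ne (p := fun l : Fin k => i ≤ l ∧ l ≤ j)]
    · refine Finset.sum_bij' (fun p hp => (⟨i + p.1, ?_⟩ : Fin k))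
        (fun l _ => ((l : ℕ) - i, (j : ℕ) - l)) ?_ ?_ ?_ ?_ ?_
      · have := Finset.HasAntidiagonal.mem_antidiagonal.mp hp
        have := j.2
        have : (i : ℕ) ≤ j := hij
        omega
      · intro p hp
        have := Finset.HasAntidiagonal.mem_antidiagonal.mp hp
        have : (i : ℕ) ≤ j := hij
        simp only [Finset.mem_filter, Finset.mem_univ, true_and, Fin.le_def]
        omega
      · intro l hl
        simp only [Finset.mem_filter, Finset.mem_univ, true_and, Fin.le_def] at hl
        simp only [Finset.HasAntidiagonal.mem_antidiagonal]
        omega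
      · rintro ⟨p, q⟩ hp
        have := Finset.HasAntidiagonal.mem_antidiagonal.mp hp
        have : (i : ℕ) ≤ j := hij
        simp only [Prod.mk.injEq]
        simp only at *
        omega
      · intro l hl
        simp only [Finset.mem_filter, Finset.mem_univ, true_and, Fin.le_def] at hl
        ext
        simp only
        omega
      · rintro ⟨p, q⟩ hp
        have hp' := Finset.HasAntidiagonal.mem_antidiagonal.mp hp
        have : (i : ℕ) ≤ j := hij
        simp only at hp'
        rw [if_pos (by simp only [Fin.le_def]; omega), if_pos (by simp only [Fin.le_def]; omega)]
        simp only
        congr 2 <;> omega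
    · intro l _ hl
      by_contra hcon
      rw [not_and_or] at hcon
      rcases hcon with h | h <;> simp [h] at hl
  · rw [if_neg hij]
    refine Finset.sum_eq_zero fun l _ => ?_
    by_cases h1 : i ≤ l
    · have h2 : ¬ l ≤ j := fun h2 => hij (h1.trans h2)
      simp [h2]
    · simp [h1]

variable (F)

/-- The algebra `C_k` of the upper triangular `k × k` matrices with constant diagonals. -/
def algC (k : ℕ) : Subalgebra F (Matrix (Fin k) (Fin k) F) where
  carrier := Set.range (toeplitz F k)
  mul_mem' := by
    rintro _ _ ⟨a, rfl⟩ ⟨b, rfl⟩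
    exact ⟨_, (toeplitz_mul k a b).symm⟩
  add_mem' := by
    rintro _ _ ⟨a, rfl⟩ ⟨b, rfl⟩
    refine ⟨a + b, ?_⟩
    ext i j
    simp only [toeplitz, Matrix.of_apply, Matrix.add_apply, Pi.add_apply]
    split_ifs <;> simp
  algebraMap_mem' := by
    intro r
    refine ⟨fun m => if m = 0 then r else 0, ?_⟩
    ext i j
    simp only [toeplitz, Matrix.of_apply, Matrix.algebraMap_matrix_apply, Algebra.algebraMap_self,
      RingHom.id_apply, Fin.le_def, Fin.ext_iff]
    split_ifs <;> first | rfl | omega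

/-- The trace algebra `C_k^{t_{α,0}}`, `k ≥ 1`: the algebra `C_k` with the trace that sends the
matrix with diagonal entry `a₁` to `α a₁`. -/
def traceC (k : ℕ) (hk : 1 ≤ k) (α : F) : TraceAlgebra F where
  carrier := algC F k
  nontrivial := by
    have : Nonempty (Fin k) := ⟨⟨0, hk⟩⟩
    infer_instance
  tr :=
    { toFun := fun M => α * (M : Matrix (Fin k) (Fin k) F) ⟨0, hk⟩ ⟨0, hk⟩
      map_add' := fun M N => by simp [mul_add]
      map_smul' := fun r M => by simp [mul_left_comm] }
  tr_mul_comm := by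
    rintro ⟨_, a, rfl⟩ ⟨_, b, rfl⟩
    change α * (toeplitz F k a * toeplitz F k b) ⟨0, hk⟩ ⟨0, hk⟩ =
      α * (toeplitz F k b * toeplitz F k a) ⟨0, hk⟩ ⟨0, hk⟩
    rw [toeplitz_mul, toeplitz_mul]
    simp [toeplitz, mul_comm]

end TruncatedPolynomials

/-! Three identities of $C_k^{t_{\alpha,0}}$ determine the shape of every member of the variety:
$xy=yx$, $\mathrm{Tr}(x)\mathrm{Tr}(y)=\alpha\mathrm{Tr}(xy)$ and
$(x-\alpha^{-1}\mathrm{Tr}(x))^k=0$. The last one forces $\mathrm{tr}(1)\ne 0$, so a member is a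
commutative algebra $B$ with trace $\alpha\chi$, where $\chi$ is a character and every $y\in
J=\ker\chi$ has $y^k=0$ (`exists_eq_ofCharacter_of_mem_generatedVariety`).

On such a $B$, splitting $x_i=(x_i-\chi(x_i))+\chi(x_i)$ turns a multilinear trace polynomial into a
sum over subsets $S$ of the variables, whose coefficients do not depend on $B$ (`eval_ofCharacter`).
If $t+1$ is the least exponent killing every element of $J$, polarization in characteristic zero
gives $J^{t+1}=0$. The multilinear identities are then exactly those whose coefficients vanish for
$|S|\le t$, and $c_n=\sum_{j\le t}\binom nj\approx n^t/t!$ (`trCodim_ofCharacter`).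

For $C_k$ this $t$ is $k-1$. If a member $A$ also has $t=k-1$, some $y\in J$ has $y^k=0\ne y^{k-1}$,
so $F[y]$ is a copy of $C_k$ inside $A$ and $A$ generates the whole variety (`trId_ofCharacter_le`).
Hence proper subvarieties have $t<k-1$. -/

open Finset Filter Asymptotics

/-! ### Polarization and growth of binomial sums. -/

section Preliminaries

/-- A vector-valued polynomial function that vanishes on an infinite field has zero coefficients. -/
lemma eq_zero_of_forall_sum_pow_smul {F V : Type*} [Field F] [Infinite F] [AddCommGroup V]
    [Module F V] (n : ℕ) (v : ℕ → V) (h : ∀ r : F, ∑ i ∈ range n, r ^ i • v i = 0)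
    {i : ℕ} (hi : i < n) : v i = 0 := by
  rw [← Module.forall_dual_apply_eq_zero_iff F]
  intro φ
  have hp : (∑ j ∈ range n, Polynomial.monomial j (φ (v j)) : Polynomial F) = 0 := by
    refine Polynomial.funext fun r => ?_
    have := congrArg φ (h r)
    simpa [Polynomial.eval_finsetSum, mul_comm] using this
  have := congrArg (fun p => Polynomial.coeff p i) hp
  simpa [Polynomial.coeff_monomial, hi] using this

/-- One step of polarization. -/
lemma pow_mul_mul_eq_zero_of_pow_succ_mul {F B : Type*} [Field F] [CharZero F] [CommRing B]
    [Algebra F B] (J : Ideal B) (m : ℕ) (c : B) (h : ∀ y ∈ J, y ^ (m + 1) * c = 0) {y z : B}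
    (hy : y ∈ J) (hz : z ∈ J) : y ^ m * z * c = 0 := by
  -- Expand $(rz+y)^{m+1}c=0$ in powers of the scalar $r$; the coefficient of $r$ is $(m+1)\,y^m z
  -- c$.
  have key := eq_zero_of_forall_sum_pow_smul (F := F) (m + 1 + 1)
    (fun i => z ^ i * y ^ (m + 1 - i) * ((m + 1).choose i : B) * c) ?_ (i := 1) (by omega)
  · have h1 : ((m + 1 : ℕ) : F) • (y ^ m * z * c) = 0 := by
      rw [← key, Nat.cast_smul_eq_nsmul, nsmul_eq_mul]
      simp only [Nat.choose_one_right, Nat.add_sub_cancel]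
      ring
    exact (smul_eq_zero.mp h1).resolve_left (Nat.cast_ne_zero.mpr (Nat.succ_ne_zero m))
  · intro r
    have := h (r • z + y) (J.add_mem (Submodule.smul_of_tower_mem J r hz) hy)
    rw [add_pow, sum_mul] at this
    rw [← this]
    refine sum_congr rfl fun i _ => ?_
    simp only [smul_pow, smul_mul_assoc]

/-- In characteristic zero, an ideal with `y ^ m = 0` for all its elements is nilpotent of index
at most `m`. -/
lemma Ideal.pow_eq_bot_of_forall_pow_eq_zero (F : Type*) {B : Type*} [Field F] [CharZero F]
    [CommRing B] [Algebra F B] (J : Ideal B) (m : ℕ) (h : ∀ y ∈ J, y ^ m = 0) : J ^ m = ⊥ := by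
  -- The factors $y$ are traded one at a time for arbitrary elements of $J$; at $j=m$ no $y$ is
  -- left.
  have key : ∀ j ≤ m, ∀ c ∈ J ^ j, ∀ y ∈ J, y ^ (m - j) * c = 0 := by
    intro j
    induction j with
    | zero => intro _ c _ y hy; simp [h y hy]
    | succ j ih =>
      intro hj c hc y hy
      rw [pow_succ] at hc
      induction hc using Submodule.mul_induction_on' with
      | mem_mul_mem c hc z hz =>
        rw [mul_comm c, ← mul_assoc]
        refine pow_mul_mul_eq_zero_of_pow_succ_mul (F := F) J _ c (fun y hy => ?_) hy hz
        rw [show m - (j + 1) + 1 = m - j by omega]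
        exact ih (by omega) c hc y hy
      | add c _ d _ hc hd => rw [mul_add, hc, hd, add_zero]
  rw [eq_bot_iff]
  intro c hc
  simpa using key m le_rfl c hc 0 J.zero_mem

lemma isEquivalent_sum_choose (t : ℕ) :
    (fun n : ℕ => ((∑ j ∈ range (t + 1), n.choose j : ℕ) : ℝ)) ~[atTop]
      (fun n : ℕ => (t.factorial : ℝ)⁻¹ * (n : ℝ) ^ t) := by
  have hmain : (fun n : ℕ => (n.choose t : ℝ)) ~[atTop]
      (fun n : ℕ => (t.factorial : ℝ)⁻¹ * (n : ℝ) ^ t) := by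
    simpa [div_eq_inv_mul] using isEquivalent_choose t
  have hlow : (fun n : ℕ => ∑ j ∈ range t, (n.choose j : ℝ)) =o[atTop]
      (fun n : ℕ => (t.factorial : ℝ)⁻¹ * (n : ℝ) ^ t) := by
    apply IsLittleO.fun_sum
    intro j hj
    rw [isLittleO_const_mul_right_iff (by positivity)]
    refine (isTheta_choose j).isBigO.trans_isLittleO ?_
    exact (isLittleO_pow_pow_atTop_of_lt (𝕜 := ℝ) (mem_range.mp hj)).comp_tendsto
      tendsto_natCast_atTop_atTop
  refine (hmain.add_isLittleO hlow).congr_left (Eventually.of_forall fun n => ?_)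
  simp [sum_range_succ, add_comm]

end Preliminaries

/-! ### Multilinear trace polynomials when the trace is a multiple of a character. -/

namespace TraceAlgebra

variable {F : Type u} [Field F]

/-- The trace algebra on a commutative algebra `B` whose trace is `α` times the character `χ`. -/
noncomputable abbrev ofCharacter (B : Type u) [CommRing B] [Algebra F B] [Nontrivial B]
    (χ : B →ₐ[F] F) (α : F) : TraceAlgebra F where
  carrier := B
  tr := α • χ.toLinearMap
  tr_mul_comm a b := by rw [mul_comm]

lemma eval_trVar (A : TraceAlgebra F) (a : ℕ → A.carrier) (w : {w : List ℕ // w ≠ []}) :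
    A.eval a (trVar F w) = algebraMap F A.carrier (A.tr (w.1.map a).prod) := by
  refine (Algebra.TensorProduct.lift_tmul _ _ _ _ _).trans ?_
  rw [map_one, one_mul, AlgHom.comp_apply, MvPolynomial.aeval_X]
  rfl

lemma eval_wordMonomial (A : TraceAlgebra F) (a : ℕ → A.carrier) (l : List ℕ) :
    A.eval a (wordMonomial F l) = (l.map a).prod := by
  refine (Algebra.TensorProduct.lift_tmul _ _ _ _ _).trans ?_
  rw [map_one, mul_one, map_list_prod, List.map_map]
  congr 2
  funext i
  simp

lemma eval_prod_trVar (A : TraceAlgebra F) (a : ℕ → A.carrier)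
    (ws : List {w : List ℕ // w ≠ []}) :
    A.eval a (ws.map (trVar F)).prod =
      algebraMap F A.carrier (ws.map fun w => A.tr (w.1.map a).prod).prod := by
  rw [map_list_prod, map_list_prod, List.map_map, List.map_map]
  congr 2
  funext w
  exact A.eval_trVar a w

section Character

variable (B : Type u) [CommRing B] [Algebra F B] [Nontrivial B] (χ : B →ₐ[F] F) (α : F)

lemma prod_tr_ofCharacter (a : ℕ → B) (ws : List {w : List ℕ // w ≠ []}) :
    (ws.map fun w => (ofCharacter B χ α).tr (w.1.map a).prod).prod =
      α ^ ws.length * ((ws.map Subtype.val).flatten.map fun i => χ (a i)).prod := by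
  induction ws with
  | nil => simp
  | cons w ws ih =>
    rw [List.map_cons, List.prod_cons, ih]
    simp only [LinearMap.smul_apply, AlgHom.toLinearMap_apply, smul_eq_mul, List.length_cons,
      List.map_cons, List.flatten_cons, List.map_append, List.prod_append, pow_succ,
      map_list_prod, List.map_map, Function.comp_def]
    ring

/-- The value of a multilinear trace monomial. -/
lemma eval_ofCharacter_monomial (a : ℕ → B) {n : ℕ} {ws : List {w : List ℕ // w ≠ []}}
    {l : List ℕ} (h : ((ws.map Subtype.val).flatten ++ l).Perm (List.range n)) :
    (ofCharacter B χ α).eval a ((ws.map (trVar F)).prod * wordMonomial F l) =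
      (α ^ ws.length * ∏ i ∈ range n \ l.toFinset, χ (a i)) • ∏ i ∈ l.toFinset, a i := by
  have hnd : ((ws.map Subtype.val).flatten ++ l).Nodup := h.nodup_iff.mpr List.nodup_range
  obtain ⟨h1, h2, h3⟩ := List.nodup_append.mp hnd
  have hset : range n \ l.toFinset = (ws.map Subtype.val).flatten.toFinset := by
    ext i
    have hi := h.mem_iff (a := i)
    simp only [List.mem_append, List.mem_range] at hi
    simp only [Finset.mem_sdiff, mem_range, List.mem_toFinset]
    constructor
    · rintro ⟨h4, h5⟩
      exact (hi.mpr h4).resolve_right h5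
    · intro h4
      exact ⟨hi.mp (Or.inl h4), fun h5 => h3 i h4 i h5 rfl⟩
  rw [map_mul, eval_prod_trVar, eval_wordMonomial, prod_tr_ofCharacter, hset,
    List.prod_toFinset _ h1, List.prod_toFinset _ h2, Algebra.smul_def]

/-- The coefficient of `∏ i ∈ S, (x i - α⁻¹ Tr (x i))`, as a functional on trace polynomials. -/
noncomputable def coeffOn (S : Finset ℕ) : FreeTraceAlgebra F →ₗ[F] F :=
  (AlgHom.snd F F F).toLinearMap ∘ₗ ((ofCharacter (F × F) (AlgHom.fst F F F) α).eval
    (fun i => if i ∈ S then (0, 1) else 1)).toLinearMap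

/-- The element $e=(0,1)$ is an idempotent killed by the character of $F\times F$, so a letter of
$S$ placed under a trace gives $0$; otherwise the second coordinate of the product is $1$ and only
the powers of $\alpha$ from the traces remain. -/
lemma coeffOn_monomial {S : Finset ℕ} {n : ℕ} (hS : S ⊆ range n)
    {ws : List {w : List ℕ // w ≠ []}} {l : List ℕ}
    (h : ((ws.map Subtype.val).flatten ++ l).Perm (List.range n)) :
    coeffOn α S ((ws.map (trVar F)).prod * wordMonomial F l) =
      if S ⊆ l.toFinset then α ^ ws.length else 0 := by
  have h1 : ∏ i ∈ l.toFinset, (if i ∈ S then ((0, 1) : F × F) else 1).2 = 1 :=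
    prod_eq_one fun i _ => by split_ifs <;> rfl
  have h2 : ∏ i ∈ range n \ l.toFinset, (if i ∈ S then ((0, 1) : F × F) else 1).1 =
      if S ⊆ l.toFinset then 1 else 0 := by
    split_ifs with hSl
    · refine prod_eq_one fun i hi => ?_
      rw [if_neg fun hi' => (Finset.mem_sdiff.mp hi).2 (hSl hi')]
      rfl
    · obtain ⟨i, hi, hil⟩ := not_subset.mp hSl
      refine prod_eq_zero (Finset.mem_sdiff.mpr ⟨hS hi, hil⟩) ?_
      rw [if_pos hi]
  have h3 := eval_ofCharacter_monomial (F × F) (AlgHom.fst F F F) α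
    (fun i => if i ∈ S then (0, 1) else 1) h
  refine (congrArg Prod.snd h3).trans ?_
  rw [Prod.smul_snd, Prod.snd_prod, h1]
  refine Eq.trans ?_ (congrArg (α ^ ws.length * ·) h2 |>.trans ?_)
  · simp
  · simp

/-- The value of a multilinear trace polynomial, in terms of its coefficients. -/
lemma eval_ofCharacter (a : ℕ → B) {n : ℕ} {f : FreeTraceAlgebra F}
    (hf : f ∈ multilinearTrace F n) :
    (ofCharacter B χ α).eval a f = ∑ S ∈ (range n).powerset,
      (coeffOn α S f * ∏ i ∈ range n \ S, χ (a i)) •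
        ∏ i ∈ S, (a i - algebraMap F B (χ (a i))) := by
  induction hf using Submodule.span_induction with
  | mem f hf =>
    obtain ⟨ws, l, h, rfl⟩ := hf
    have hl : l.toFinset ⊆ range n := fun i hi => by
      have := (h.mem_iff (a := i)).mp (List.mem_append_right _ (List.mem_toFinset.mp hi))
      simpa using this
    rw [eval_ofCharacter_monomial B χ α a h]
    have hexp : ∏ i ∈ l.toFinset, a i = ∑ S ∈ l.toFinset.powerset,
        (∏ i ∈ S, (a i - algebraMap F B (χ (a i)))) *
          ∏ i ∈ l.toFinset \ S, algebraMap F B (χ (a i)) := by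
      rw [← prod_add]
      exact prod_congr rfl fun i _ => by ring
    rw [hexp, smul_sum]
    refine sum_subset_zero_on_sdiff (powerset_mono.mpr hl) ?_ ?_
    · intro S hS
      rw [Finset.mem_sdiff, mem_powerset, mem_powerset] at hS
      rw [coeffOn_monomial α hS.1 h, if_neg hS.2, zero_mul, zero_smul]
    · intro S hS
      rw [mem_powerset] at hS
      rw [coeffOn_monomial α (hS.trans hl) h, if_pos hS,
        ← prod_sdiff (sdiff_subset_sdiff le_rfl hS : range n \ l.toFinset ⊆ range n \ S),
        sdiff_sdiff_sdiff_cancel_left hl, ← map_prod (algebraMap F B), mul_comm (∏ i ∈ S, _),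
        ← Algebra.smul_def, smul_smul]
      ring_nf
  | zero => simp
  | add f g _ _ hf hg =>
    rw [map_add, hf, hg, ← sum_add_distrib]
    refine sum_congr rfl fun S _ => ?_
    rw [map_add, add_mul, add_smul]
  | smul r f _ hf =>
    rw [map_smul, hf, smul_sum]
    refine sum_congr rfl fun S _ => ?_
    rw [map_smul, smul_smul, smul_eq_mul, mul_assoc]

variable {B χ α}

/-- Putting $y$ for the variables in $S$ and $1$ for the others isolates the term of $S$: if
$T\not\subseteq S$ a factor $1-\chi(1)=0$ appears, and if $S\not\subseteq T$ a factor $\chi(y)=0$.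
-/
lemma coeffOn_eq_zero_of_mem_trId {y : B} (hy : χ y = 0) {n : ℕ} {S : Finset ℕ}
    (hS : S ⊆ range n) (hyS : y ^ S.card ≠ 0) {f : FreeTraceAlgebra F}
    (hf : f ∈ multilinearTrace F n) (hfA : f ∈ (ofCharacter B χ α).trId) :
    coeffOn α S f = 0 := by
  have h := ((ofCharacter B χ α).mem_trId f).mp hfA (fun i => if i ∈ S then y else 1)
  rw [eval_ofCharacter B χ α _ hf, sum_eq_single S] at h
  · have h1 : ∏ i ∈ range n \ S, χ (if i ∈ S then y else 1) = 1 :=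
      prod_eq_one fun i hi => by rw [if_neg (Finset.mem_sdiff.mp hi).2, map_one]
    have h2 : ∏ i ∈ S, ((if i ∈ S then y else 1) -
        algebraMap F B (χ (if i ∈ S then y else 1))) = y ^ S.card := by
      rw [← prod_const]
      exact prod_congr rfl fun i hi => by simp [hi, hy]
    rw [h1, h2, mul_one] at h
    exact (smul_eq_zero.mp h).resolve_right hyS
  · intro T hT hTS
    rw [mem_powerset] at hT
    by_cases hST : S ⊆ T
    · obtain ⟨i, hiT, hiS⟩ := not_subset.mp fun h' => hTS (subset_antisymm h' hST)
      rw [prod_eq_zero hiT (by simp [hiS]), smul_zero]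
    · obtain ⟨i, hiS, hiT⟩ := not_subset.mp hST
      rw [prod_eq_zero (Finset.mem_sdiff.mpr ⟨hS hiS, hiT⟩) (by simp [hiS, hy]), mul_zero, zero_smul]
  · exact fun h' => absurd (mem_powerset.mpr hS) h'

/-- The term of $S$ contains a product of $|S|$ elements of $\ker\chi$, so it vanishes by itself
once $|S|>t$. -/
lemma mem_trId_of_coeffOn_eq_zero {t : ℕ} (hJ : RingHom.ker χ ^ (t + 1) = ⊥) {n : ℕ}
    {f : FreeTraceAlgebra F} (hf : f ∈ multilinearTrace F n)
    (h : ∀ S ⊆ range n, S.card ≤ t → coeffOn α S f = 0) : f ∈ (ofCharacter B χ α).trId := by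
  refine ((ofCharacter B χ α).mem_trId f).mpr fun a => ?_
  rw [eval_ofCharacter B χ α a hf]
  refine sum_eq_zero fun S hS => ?_
  rw [mem_powerset] at hS
  by_cases hc : S.card ≤ t
  · rw [h S hS hc, zero_mul, zero_smul]
  · have h1 : ∏ i ∈ S, (a i - algebraMap F B (χ (a i))) ∈ ∏ _i ∈ S, RingHom.ker χ :=
      Ideal.prod_mem_prod fun i _ => by simp [RingHom.mem_ker]
    rw [prod_const] at h1
    have h2 := Ideal.pow_le_pow_right (show t + 1 ≤ S.card by omega) h1
    rw [hJ, Ideal.mem_bot] at h2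
    rw [h2, smul_zero]

end Character

end TraceAlgebra

lemma classTrId_generatedVariety {F : Type u} [Field F] (A : TraceAlgebra F) :
    classTrId (generatedVariety A) = A.trId := by
  refine le_antisymm (iInf₂_le A fun f hf => hf) (le_iInf₂ fun B hB f hf => hB f hf)

/-! ### Codimensions. -/

namespace TraceAlgebra

section Codimension

variable {F : Type u} [Field F] (α : F)

/-- The subsets of `{0, …, n - 1}` with at most `t` elements. -/
def smallSubsets (n t : ℕ) : Finset (Finset ℕ) := {S ∈ (range n).powerset | S.card ≤ t}

lemma card_smallSubsets (n t : ℕ) :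
    (smallSubsets n t).card = ∑ j ∈ range (t + 1), n.choose j := by
  rw [card_eq_sum_card_fiberwise (f := card) (t := range (t + 1))
    (fun S hS => by
      simpa [Nat.lt_succ_iff] using (mem_filter.mp (mem_coe.mp hS)).2)]
  refine sum_congr rfl fun j hj => ?_
  rw [← card_range n, ← card_powersetCard, card_range]
  congr 1
  ext S
  have hj' : j ≤ t := Nat.lt_succ_iff.mp (mem_range.mp hj)
  simp only [smallSubsets, mem_filter, mem_powerset, mem_powersetCard]
  exact ⟨fun h => ⟨h.1.1, h.2⟩, fun h => ⟨⟨h.1, h.2.trans_le hj'⟩, h.2⟩⟩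

/-- The coefficients of index at most `t` of the multilinear trace polynomials. -/
noncomputable def coeffMap (n t : ℕ) :
    multilinearTrace F n →ₗ[F] (smallSubsets n t → F) :=
  LinearMap.pi fun S => coeffOn α S.1 ∘ₗ (multilinearTrace F n).subtype

variable {α}

/-- Triangularity: the monomial with $S$ outside the traces and every other letter in its own trace
has coefficient a fixed power of $\alpha$ at each $T\subseteq S$ and $0$ elsewhere. Since
$\alpha\ne0$, induction on $|S|$ produces every basis vector. -/
lemma coeffMap_surjective (hα : α ≠ 0) (n t : ℕ) :
    Function.Surjective (coeffMap α n t) := by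
  rw [← LinearMap.range_eq_top, eq_top_iff, ← (Pi.basisFun F (smallSubsets n t)).span_eq,
    Submodule.span_le]
  rintro _ ⟨S, rfl⟩
  rw [Pi.basisFun_apply, SetLike.mem_coe]
  induction hc : S.1.card using Nat.strong_induction_on generalizing S with
  | _ c ih =>
  subst hc
  obtain ⟨hS, hSt⟩ := mem_filter.mp S.2
  rw [mem_powerset] at hS
  let ws : List {w : List ℕ // w ≠ []} :=
    (range n \ S.1).toList.map fun i => ⟨[i], List.cons_ne_nil _ _⟩
  have hperm : ((ws.map Subtype.val).flatten ++ S.1.toList).Perm (List.range n) := by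
    have h1 : (ws.map Subtype.val).flatten = (range n \ S.1).toList := by
      simp [ws, List.map_map, Function.comp_def, ← List.flatMap_def]
    rw [h1, List.perm_ext_iff_of_nodup ?_ List.nodup_range]
    · intro i
      simp only [List.mem_append, mem_toList, Finset.mem_sdiff, mem_range, List.mem_range]
      have := @hS i
      rw [mem_range] at this
      tauto
    · refine List.nodup_append.mpr ⟨nodup_toList _, nodup_toList _, ?_⟩
      rintro i hi j hj rfl
      exact (Finset.mem_sdiff.mp (mem_toList.mp hi)).2 (mem_toList.mp hj)
  let g : multilinearTrace F n :=
    ⟨_, Submodule.subset_span ⟨ws, S.1.toList, hperm, rfl⟩⟩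
  have hg : coeffMap α n t g = α ^ ws.length •
      ∑ T ∈ univ.filter (fun T : smallSubsets n t => T.1 ⊆ S.1), Pi.single T (1 : F) := by
    funext T
    have hT := mem_powerset.mp (mem_filter.mp T.2).1
    refine (coeffOn_monomial α hT hperm).trans ?_
    simp [Finset.sum_apply, Pi.single_apply]
  have hsplit : univ.filter (fun T : smallSubsets n t => T.1 ⊆ S.1) =
      insert S (univ.filter (fun T : smallSubsets n t => T.1 ⊂ S.1)) := by
    ext T
    simp only [mem_filter, mem_univ, true_and, mem_insert, Subtype.ext_iff]
    exact le_iff_eq_or_lt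
  rw [hsplit, sum_insert (by simp)] at hg
  have hsingle : Pi.single S (1 : F) = (α ^ ws.length)⁻¹ • coeffMap α n t g -
      ∑ T ∈ univ.filter (fun T : smallSubsets n t => T.1 ⊂ S.1), Pi.single T (1 : F) := by
    rw [hg, smul_smul, inv_mul_cancel₀ (pow_ne_zero _ hα), one_smul, add_sub_cancel_right]
  rw [hsingle]
  refine Submodule.sub_mem _ (Submodule.smul_mem _ _ ⟨g, rfl⟩) (Submodule.sum_mem _ fun T hT => ?_)
  exact ih _ (card_lt_card (mem_filter.mp hT).2) T rfl

variable {B : Type u} [CommRing B] [Algebra F B] [Nontrivial B] {χ : B →ₐ[F] F}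

lemma trCodim_ofCharacter (hα : α ≠ 0) {t : ℕ} (hJ : RingHom.ker χ ^ (t + 1) = ⊥)
    {y : B} (hy : χ y = 0) (hyt : y ^ t ≠ 0) (n : ℕ) :
    trCodim (generatedVariety (ofCharacter B χ α)) n = ∑ j ∈ range (t + 1), n.choose j := by
  have hker : (classTrId (generatedVariety (ofCharacter B χ α))).comap
      (multilinearTrace F n).subtype = LinearMap.ker (coeffMap α n t) := by
    rw [classTrId_generatedVariety]
    ext f
    rw [Submodule.mem_comap, LinearMap.mem_ker]
    constructor
    · intro hf
      funext S
      obtain ⟨hS, hSt⟩ := mem_filter.mp S.2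
      exact coeffOn_eq_zero_of_mem_trId hy (mem_powerset.mp hS)
        (fun h0 => hyt (pow_eq_zero_of_le hSt h0)) f.2 hf
    · intro hf
      refine mem_trId_of_coeffOn_eq_zero hJ f.2 fun S hS hSt => ?_
      exact congrFun hf ⟨S, mem_filter.mpr ⟨mem_powerset.mpr hS, hSt⟩⟩
  rw [trCodim, hker,
    ((coeffMap α n t).quotKerEquivOfSurjective (coeffMap_surjective hα n t)).finrank_eq,
    Module.finrank_fintype_fun_eq_card, Fintype.card_coe, card_smallSubsets]

lemma codimAsymp_ofCharacter (hα : α ≠ 0) {t : ℕ} (hJ : RingHom.ker χ ^ (t + 1) = ⊥)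
    {y : B} (hy : χ y = 0) (hyt : y ^ t ≠ 0) :
    CodimAsymp (generatedVariety (ofCharacter B χ α)) (t.factorial : ℝ)⁻¹ t := by
  unfold CodimAsymp
  simp only [trCodim_ofCharacter hα hJ hy hyt]
  exact isEquivalent_sum_choose t

end Codimension

end TraceAlgebra

/-! ### Characters from trace identities, and transfer of identities. -/

namespace TraceAlgebra

variable {F : Type u} [Field F]

/-- Homomorphisms of algebras with trace commute with the evaluation of trace polynomials. -/
lemma map_eval {A A' : TraceAlgebra F} (φ : A.carrier →ₐ[F] A'.carrier)
    (hφ : ∀ a, A'.tr (φ a) = A.tr a) (a : ℕ → A.carrier) (f : FreeTraceAlgebra F) :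
    φ (A.eval a f) = A'.eval (fun i => φ (a i)) f := by
  have h : φ.comp (A.eval a) = A'.eval (fun i => φ (a i)) := by
    refine Algebra.TensorProduct.ext (FreeAlgebra.hom_ext ?_) (MvPolynomial.algHom_ext ?_)
    · funext i
      have h1 := A.eval_wordMonomial a [i]
      have h2 := A'.eval_wordMonomial (fun i => φ (a i)) [i]
      simp only [wordMonomial, List.map_cons, List.map_nil, List.prod_singleton] at h1 h2
      exact (congrArg φ h1).trans h2.symm
    · rintro ⟨c, hc⟩
      induction c using Quotient.inductionOn with
      | _ w =>
      have hw : w ≠ [] := fun h => hc (congrArg _ h)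
      have h1 := A.eval_trVar a ⟨w, hw⟩
      have h2 := A'.eval_trVar (fun i => φ (a i)) ⟨w, hw⟩
      refine (congrArg φ h1).trans (Eq.trans ?_ h2.symm)
      rw [φ.commutes, ← hφ, map_list_prod, List.map_map]
      rfl
  exact DFunLike.congr_fun h f

/-- A commutative algebra with trace whose trace is multiplicative up to the factor `α` is given
by a character. -/
lemma exists_eq_ofCharacter {α : F} (A : TraceAlgebra F) (hc : ∀ a b : A.carrier, a * b = b * a)
    (htr : ∀ a b : A.carrier, A.tr a * A.tr b = α * A.tr (a * b)) (h1 : A.tr 1 ≠ 0) :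
    ∃ (B : Type u) (_ : CommRing B) (_ : Algebra F B) (_ : Nontrivial B) (χ : B →ₐ[F] F),
      A = ofCharacter B χ α := by
  have hone : A.tr 1 = α := by
    have := htr 1 1
    rw [mul_one] at this
    exact mul_right_cancel₀ h1 this
  rw [hone] at h1
  obtain ⟨B, tr, htrc⟩ := A
  let χ : B →ₐ[F] F := AlgHom.ofLinearMap (α⁻¹ • tr)
    (by
      change α⁻¹ * tr 1 = 1
      rw [show tr 1 = α from hone, inv_mul_cancel₀ h1])
    (fun a b => by
      change α⁻¹ * tr (a * b) = (α⁻¹ * tr a) * (α⁻¹ * tr b)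
      have : tr a * tr b = α * tr (a * b) := htr a b
      rw [mul_mul_mul_comm, this]
      field_simp)
  -- The commutative structure extends the given ring, so that both trace algebras have the same
  -- underlying ring.
  refine ⟨B, { (inferInstance : Ring B) with mul_comm := hc }, inferInstance, inferInstance, χ, ?_⟩
  have : tr = α • χ.toLinearMap := by
    ext a
    change tr a = α * (α⁻¹ * tr a)
    rw [mul_inv_cancel_left₀ h1]
  subst_vars
  unfold ofCharacter
  congr

section Character

variable {B : Type u} [CommRing B] [Algebra F B] {χ : B →ₐ[F] F} {α : F}

lemma character_aeval {y : B} (hy : χ y = 0) (p : Polynomial F) :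
    χ (Polynomial.aeval y p) = p.coeff 0 := by
  rw [← Polynomial.aeval_algHom_apply, hy, Polynomial.coeff_zero_eq_aeval_zero]

lemma X_pow_dvd_of_aeval_eq_zero {k : ℕ} {y : B} (hyk : y ^ k = 0) (hy : y ^ (k - 1) ≠ 0)
    {p : Polynomial F} (hp : Polynomial.aeval y p = 0) : Polynomial.X ^ k ∣ p := by
  rw [Polynomial.X_pow_dvd_iff]
  intro d
  induction d using Nat.strong_induction_on with
  | _ d ih =>
  intro hd
  obtain ⟨q, rfl⟩ := Polynomial.X_pow_dvd_iff.mpr fun e he => ih e he (he.trans hd)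
  have hq : q = Polynomial.C (q.coeff 0) + Polynomial.X * q.divX := by
    rw [add_comm, Polynomial.X_mul_divX_add]
  have h1 : q.coeff 0 • y ^ (k - 1) = 0 := by
    -- With $p=X^dq$, multiplying $p(y)=0$ by $y^{k-1-d}$ leaves only $q(0)\,y^{k-1}$.
    have h2 := congrArg (y ^ (k - 1 - d) * ·) hp
    simp only [map_mul, map_pow, Polynomial.aeval_X, mul_zero] at h2
    rw [← mul_assoc, ← pow_add, Nat.sub_add_cancel (by omega), hq] at h2
    simp only [map_add, map_mul, Polynomial.aeval_C, Polynomial.aeval_X, mul_add] at h2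
    rwa [← mul_assoc, ← pow_succ, Nat.sub_add_cancel (by omega), hyk, zero_mul, add_zero,
      mul_comm, ← Algebra.smul_def] at h2
  simpa [Polynomial.coeff_X_pow_mul'] using (smul_eq_zero.mp h1).resolve_right hy

/-- Identities pass to a truncated polynomial algebra from any algebra containing a nilpotent
element of the same index in the kernel of the character. -/
lemma trId_ofCharacter_le [Nontrivial B] {k : ℕ} {y : B} (hχ : χ y = 0) (hyk : y ^ k = 0)
    (hy : y ^ (k - 1) ≠ 0) {C : Type u} [CommRing C] [Algebra F C] [Nontrivial C]
    {ψ : C →ₐ[F] F} {z : C} (hψ : ψ z = 0) (hzk : z ^ k = 0)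
    (hz : Function.Surjective (Polynomial.aeval (R := F) z)) :
    (ofCharacter B χ α).trId ≤ (ofCharacter C ψ α).trId := by
  intro f hf
  rw [mem_trId] at hf ⊢
  intro c
  choose p hp using fun i => hz (c i)
  -- Both evaluations factor through $F[X]$ with trace $p\mapsto\alpha p(0)$. The value of $f$ there
  -- vanishes at $y$, hence is divisible by $X^k$, hence vanishes at $z$.
  have hP := fun (D : Type u) [CommRing D] [Algebra F D] [Nontrivial D] (η : D →ₐ[F] F) (x : D)
      (hx : η x = 0) => map_eval
    (A := ofCharacter (ULift.{u} (Polynomial F)) ((Polynomial.aeval (0 : F)).comp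
      (ULift.algEquiv (R := F)).toAlgHom) α)
    (A' := ofCharacter D η α) ((Polynomial.aeval x).comp (ULift.algEquiv (R := F)).toAlgHom)
    (fun q => by
      change α * η (Polynomial.aeval x q.down) = α * Polynomial.aeval 0 q.down
      rw [character_aeval hx, Polynomial.coeff_zero_eq_aeval_zero])
    (fun i => ULift.up (p i)) f
  obtain ⟨q, hq⟩ := X_pow_dvd_of_aeval_eq_zero hyk hy ((hP B χ y hχ).trans (hf _))
  have h := hP C ψ z hψ
  have h0 : Polynomial.aeval z (Polynomial.X ^ k * q) = 0 := by simp [hzk]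
  rw [← hq] at h0
  rw [← funext hp]
  exact h.symm.trans h0

end Character

/-- The codimension growth of a commutative algebra with multiplicative trace and nilpotent
trace kernel. -/
lemma exists_codimAsymp [CharZero F] {α : F} (hα : α ≠ 0) {B : Type u} [CommRing B] [Algebra F B]
    [Nontrivial B] {χ : B →ₐ[F] F} {k : ℕ} (hk : ∀ y : B, χ y = 0 → y ^ k = 0) :
    ∃ t < k, (∀ y : B, χ y = 0 → y ^ (t + 1) = 0) ∧ (∃ y : B, χ y = 0 ∧ y ^ t ≠ 0) ∧
      ∃ q : ℝ, 0 < q ∧ CodimAsymp (generatedVariety (ofCharacter B χ α)) q t := by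
  classical
  have hex : ∃ m, ∀ y : B, χ y = 0 → y ^ m = 0 := ⟨k, hk⟩
  obtain ⟨t, ht⟩ : ∃ t, Nat.find hex = t + 1 := by
    -- The least exponent is positive, because $0^0=1\ne0$.
    refine Nat.exists_eq_succ_of_ne_zero fun h0 => ?_
    have := Nat.find_spec hex 0 (map_zero χ)
    rw [h0, pow_zero] at this
    exact one_ne_zero this
  have hspec := Nat.find_spec hex
  have hmin := Nat.find_min hex (m := t) (by omega)
  have hle := Nat.find_min' hex hk
  rw [ht] at hspec hle
  push Not at hmin
  obtain ⟨y, hy, hyt⟩ := hmin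
  refine ⟨t, hle, hspec, ⟨y, hy, hyt⟩, _, by positivity, codimAsymp_ofCharacter hα ?_ hy hyt⟩
  exact Ideal.pow_eq_bot_of_forall_pow_eq_zero F _ _ fun z hz => hspec z (RingHom.mem_ker.mp hz)

end TraceAlgebra

/-! ### The algebra $C_k$ as a quotient of $F[X]$. -/

section Toeplitz

variable {F : Type u} [Field F]

/-- The homomorphism from polynomials onto the algebra `C_k`. -/
noncomputable def polyToAlgC (F : Type u) [Field F] (k : ℕ) : Polynomial F →ₐ[F] algC F k :=
  AlgHom.ofLinearMap
    { toFun := fun p => ⟨toeplitz F k p.coeff, p.coeff, rfl⟩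
      map_add' := fun p q => by
        ext i j
        simp only [toeplitz, Polynomial.coeff_add, Matrix.of_apply, AddMemClass.coe_add,
          Matrix.add_apply]
        split_ifs <;> simp
      map_smul' := fun r p => by
        ext i j
        simp [toeplitz] }
    (by
      ext i j
      simp only [toeplitz, LinearMap.coe_mk, AddHom.coe_mk, Matrix.of_apply,
        Polynomial.coeff_one, OneMemClass.coe_one, Matrix.one_apply, Fin.le_def, Fin.ext_iff]
      split_ifs <;> first | rfl | omega)
    (fun p q => by
      refine Subtype.ext (Eq.trans ?_ (toeplitz_mul k p.coeff q.coeff).symm)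
      exact congrArg (toeplitz F k) (funext fun m => Polynomial.coeff_mul p q m))

lemma polyToAlgC_apply (k : ℕ) (p : Polynomial F) (i j : Fin k) :
    (polyToAlgC F k p : Matrix (Fin k) (Fin k) F) i j =
      if i ≤ j then p.coeff ((j : ℕ) - (i : ℕ)) else 0 :=
  rfl

lemma polyToAlgC_surjective (k : ℕ) : Function.Surjective (polyToAlgC F k) := by
  rintro ⟨_, b, rfl⟩
  refine ⟨∑ m ∈ range k, Polynomial.monomial m (b m), ?_⟩
  ext i j
  rw [polyToAlgC_apply]
  have : (j : ℕ) - i < k := by omega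
  simp [toeplitz, Polynomial.coeff_monomial, this]

lemma polyToAlgC_X_pow_self (k : ℕ) : polyToAlgC F k (Polynomial.X ^ k) = 0 := by
  ext i j
  rw [polyToAlgC_apply, Polynomial.coeff_X_pow, if_neg (by omega : ¬ (j : ℕ) - i = k)]
  simp

lemma polyToAlgC_X_pow_pred_ne_zero {k : ℕ} (hk : 1 ≤ k) :
    polyToAlgC F k (Polynomial.X ^ (k - 1)) ≠ 0 := by
  intro h
  have h1 := polyToAlgC_apply k (Polynomial.X ^ (k - 1) : Polynomial F) ⟨0, hk⟩ ⟨k - 1, by omega⟩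
  rw [h, if_pos (Fin.mk_le_mk.mpr (Nat.zero_le _)), Polynomial.coeff_X_pow,
    if_pos (Nat.sub_zero _)] at h1
  exact zero_ne_one h1

lemma traceC_tr_polyToAlgC {k : ℕ} (hk : 1 ≤ k) (α : F) (p : Polynomial F) :
    (traceC F k hk α).tr (polyToAlgC F k p) = α * p.coeff 0 := by
  change α * (polyToAlgC F k p : Matrix (Fin k) (Fin k) F) ⟨0, hk⟩ ⟨0, hk⟩ = _
  rw [polyToAlgC_apply, if_pos le_rfl, Nat.sub_self]

lemma traceC_mul_comm {k : ℕ} (hk : 1 ≤ k) (α : F) (a b : (traceC F k hk α).carrier) :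
    a * b = b * a := by
  obtain ⟨p, rfl⟩ := polyToAlgC_surjective k a
  obtain ⟨q, rfl⟩ := polyToAlgC_surjective k b
  exact (map_mul (polyToAlgC F k) p q).symm.trans
    ((congrArg _ (mul_comm p q)).trans (map_mul (polyToAlgC F k) q p))

lemma traceC_tr_mul_tr {k : ℕ} (hk : 1 ≤ k) (α : F) (a b : (traceC F k hk α).carrier) :
    (traceC F k hk α).tr a * (traceC F k hk α).tr b = α * (traceC F k hk α).tr (a * b) := by
  obtain ⟨p, rfl⟩ := polyToAlgC_surjective k a
  obtain ⟨q, rfl⟩ := polyToAlgC_surjective k b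
  have h := congrArg (traceC F k hk α).tr (map_mul (polyToAlgC F k) p q)
  rw [traceC_tr_polyToAlgC, Polynomial.mul_coeff_zero] at h
  refine Eq.trans ?_ (congrArg (α * ·) h)
  rw [traceC_tr_polyToAlgC, traceC_tr_polyToAlgC]
  ring

lemma traceC_tr_one {k : ℕ} (hk : 1 ≤ k) (α : F) : (traceC F k hk α).tr 1 = α := by
  have h := congrArg (traceC F k hk α).tr (map_one (polyToAlgC F k))
  rw [traceC_tr_polyToAlgC, Polynomial.coeff_one_zero, mul_one] at h
  exact h.symm

lemma traceC_exists_generator {k : ℕ} (hk : 1 ≤ k) (α : F) :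
    ∃ z : (traceC F k hk α).carrier, (traceC F k hk α).tr z = 0 ∧ z ^ k = 0 ∧ z ^ (k - 1) ≠ 0 ∧
      Function.Surjective (Polynomial.aeval (R := F) z) := by
  refine ⟨polyToAlgC F k Polynomial.X, ?_, ?_, ?_, ?_⟩
  · rw [traceC_tr_polyToAlgC, Polynomial.coeff_X_zero, mul_zero]
  · exact (map_pow (polyToAlgC F k) Polynomial.X k).symm.trans (polyToAlgC_X_pow_self k)
  · exact fun h => polyToAlgC_X_pow_pred_ne_zero hk
      ((map_pow (polyToAlgC F k) Polynomial.X (k - 1)).trans h)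
  · have h : Polynomial.aeval (polyToAlgC F k Polynomial.X) = polyToAlgC F k :=
      Polynomial.algHom_ext (Polynomial.aeval_X _)
    intro c
    obtain ⟨p, hp⟩ := polyToAlgC_surjective k c
    exact ⟨p, (DFunLike.congr_fun h p).trans hp⟩

lemma traceC_pow_eq_zero {k : ℕ} (hk : 1 ≤ k) {α : F} (hα : α ≠ 0)
    (a : (traceC F k hk α).carrier) (ha : (traceC F k hk α).tr a = 0) : a ^ k = 0 := by
  obtain ⟨p, rfl⟩ := polyToAlgC_surjective k a
  rw [traceC_tr_polyToAlgC] at ha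
  obtain ⟨q, rfl⟩ := Polynomial.X_dvd_iff.mpr ((mul_eq_zero.mp ha).resolve_left hα)
  refine (map_pow (polyToAlgC F k) (Polynomial.X * q) k).symm.trans ?_
  have h : polyToAlgC F k ((Polynomial.X * q) ^ k) = 0 := by
    rw [mul_pow, map_mul, polyToAlgC_X_pow_self, zero_mul]
  exact h

end Toeplitz

/-! ### Members of the variety, and minimality. -/

section Members

variable {F : Type u} [Field F] {k : ℕ} (hk : 1 ≤ k) {α : F} {A : TraceAlgebra F}

/-- The identities of `C_k` force its members to be given by a character with nilpotent kernel. -/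
lemma exists_eq_ofCharacter_of_mem_generatedVariety (hα : α ≠ 0)
    (hA : A ∈ generatedVariety (traceC F k hk α)) :
    ∃ (B : Type u) (_ : CommRing B) (_ : Algebra F B) (_ : Nontrivial B) (χ : B →ₐ[F] F),
      A = TraceAlgebra.ofCharacter B χ α ∧ ∀ y : B, χ y = 0 → y ^ k = 0 := by
  have hx (D : TraceAlgebra F) (a : ℕ → D.carrier) (i : ℕ) :
      D.eval a (wordMonomial F [i]) = a i := by
    rw [D.eval_wordMonomial]; simp
  have hT (D : TraceAlgebra F) (a : ℕ → D.carrier) (w : List ℕ) (hw : w ≠ []) :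
      D.eval a (trVar F ⟨w, hw⟩) = algebraMap F D.carrier (D.tr (w.map a).prod) :=
    D.eval_trVar a _
  have hc : ∀ a b : A.carrier, a * b = b * a := by
    intro a b
    have hf := hA (wordMonomial F [0] * wordMonomial F [1] -
      wordMonomial F [1] * wordMonomial F [0]) (by
        rw [TraceAlgebra.mem_trId]
        intro c
        rw [map_sub, map_mul, map_mul, traceC_mul_comm hk α, sub_self])
    rw [TraceAlgebra.mem_trId] at hf
    have := hf (fun i => if i = 0 then a else b)
    rw [map_sub, map_mul, map_mul, hx, hx] at this
    simpa [sub_eq_zero] using this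
  have htr : ∀ a b : A.carrier, A.tr a * A.tr b = α * A.tr (a * b) := by
    intro a b
    have hf := hA (trVar F ⟨[0], by simp⟩ * trVar F ⟨[1], by simp⟩ -
      algebraMap F _ α * trVar F ⟨[0, 1], by simp⟩) (by
        rw [TraceAlgebra.mem_trId]
        intro c
        rw [map_sub, map_mul, map_mul, hT, hT, hT, AlgHom.commutes, ← map_mul (algebraMap F _),
          ← map_mul (algebraMap F _),
          sub_eq_zero]
        congr 1
        simpa using traceC_tr_mul_tr hk α (c 0) (c 1))
    rw [TraceAlgebra.mem_trId] at hf
    have := hf (fun i => if i = 0 then a else b)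
    rw [map_sub, map_mul, map_mul, hT, hT, hT, AlgHom.commutes, ← map_mul (algebraMap F _),
          ← map_mul (algebraMap F _),
      sub_eq_zero] at this
    simpa using (algebraMap F A.carrier).injective this
  have hnil : ∀ a : A.carrier, (a - algebraMap F _ (α⁻¹ * A.tr a)) ^ k = 0 := by
    intro a
    have hf := hA ((wordMonomial F [0] -
      algebraMap F _ α⁻¹ * trVar F ⟨[0], by simp⟩) ^ k) (by
        rw [TraceAlgebra.mem_trId]
        intro c
        rw [map_pow, map_sub, map_mul, hx, hT, AlgHom.commutes, ← map_mul]
        refine traceC_pow_eq_zero hk hα _ ?_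
        rw [map_sub, Algebra.algebraMap_eq_smul_one, map_smul, traceC_tr_one, smul_eq_mul]
        simp only [List.map_cons, List.map_nil, List.prod_singleton]
        field_simp
        simp)
    rw [TraceAlgebra.mem_trId] at hf
    have := hf (fun _ => a)
    rw [map_pow, map_sub, map_mul, hx, hT, AlgHom.commutes, ← map_mul] at this
    simpa using this
  -- If $\mathrm{tr}(1)=0$, the nil identity at $1$ would read $1^k=0$.
  have h1 : A.tr 1 ≠ 0 := by
    intro h
    have := hnil 1
    rw [h, mul_zero, map_zero, sub_zero, one_pow] at this
    exact one_ne_zero this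
  obtain ⟨B, i1, i2, i3, χ, rfl⟩ := A.exists_eq_ofCharacter hc htr h1
  refine ⟨B, i1, i2, i3, χ, rfl, fun y hy => ?_⟩
  have h := hnil y
  have htry : (TraceAlgebra.ofCharacter B χ α).tr y = 0 := by
    change α * χ y = 0
    rw [hy, mul_zero]
  rw [htry, mul_zero, map_zero, sub_zero] at h
  exact h

end Members

lemma mem_generatedVariety_self {F : Type u} [Field F] (A : TraceAlgebra F) :
    A ∈ generatedVariety A := fun _ hf => hf

theorem mainTheorem8 {F : Type u} [Field F] [CharZero F] (k : ℕ) (hk : 2 ≤ k)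
    (α : F) (hα : α ≠ 0) :
    IsMinimalOfPolynomialGrowth
      (generatedVariety (traceC F k (le_trans one_le_two hk) α)) := by
  have hk1 : 1 ≤ k := le_trans one_le_two hk
  refine ⟨⟨(traceC F k hk1 α).trId, rfl⟩, k - 1, by omega, ?_⟩
  have hgen := traceC_exists_generator (F := F) hk1 α
  have hmem : ∀ A ∈ generatedVariety (traceC F k hk1 α), _ := fun A hA =>
    exists_eq_ofCharacter_of_mem_generatedVariety hk1 hα hA
  change (∃ q : ℝ, 0 < q ∧ CodimAsymp (generatedVariety (traceC F k hk1 α)) q (k - 1)) ∧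
    ∀ A : TraceAlgebra F, FiniteDimensional F A.carrier →
      generatedVariety A ⊂ generatedVariety (traceC F k hk1 α) →
      ∃ t : ℕ, t < k - 1 ∧ ∃ q' : ℝ, 0 < q' ∧ CodimAsymp (generatedVariety A) q' t
  have hself := mem_generatedVariety_self (traceC F k hk1 α)
  -- The matrices are no longer needed: the generator $z$ and the structure of members suffice.
  generalize traceC F k hk1 α = D at *
  obtain ⟨C, _, _, _, ψ, rfl, hψ⟩ := hmem D hself
  obtain ⟨z, hz0, hzk, hzk', hz⟩ := hgen
  replace hz0 : ψ z = 0 := (mul_eq_zero.mp (show α * ψ z = 0 from hz0)).resolve_left hα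
  refine ⟨?_, fun A _ hA => ?_⟩
  · obtain ⟨t, htk, ht, -, q, hq, hasymp⟩ := TraceAlgebra.exists_codimAsymp hα hψ
    have htk' : t = k - 1 := by
      by_contra hne
      -- A smaller $t$ would contradict $z^{k-1}\ne0$.
      exact hzk' (pow_eq_zero_of_le (by omega) (ht z hz0))
    exact ⟨q, hq, htk' ▸ hasymp⟩
  · obtain ⟨B, _, _, _, χ, rfl, hχ⟩ := hmem A (hA.1 (mem_generatedVariety_self A))
    obtain ⟨t, htk, ht, ⟨y, hy, hyt⟩, q, hq, hasymp⟩ := TraceAlgebra.exists_codimAsymp hα hχ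
    -- If $t=k-1$, the identities of $A$ pass to $C_k$ through $y$, and the inclusion of varieties
    -- is not proper.
    refine ⟨t, lt_of_le_of_ne (by omega) fun htk' => hA.2 fun D hD f hf => ?_, q, hq, hasymp⟩
    subst htk'
    exact hD f (TraceAlgebra.trId_ofCharacter_le hy (hχ y hy) hyt hz0 hzk hz hf)
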